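/- **Setting.** Let $d\ge 1$. An update family is a finite collection $\mathcal U$ of finite subsets of $\mathbb Z^d\setminus\{\mathbf 0\}$. For $A\subset\mathbb Z^d$ put $A_0=A$, $A_{t}=A_{t-1}\cup\{x\in\mathbb Z^d: x+X\subset A_{t-1}\text{ for some }X\in\mathcal U\}$ and $[A]_{\mathcal U}=\bigcup_{t\ge 0}A_t$; the set $A$ is $\mathcal U$-closed if $[A]_{\mathcal U}=A$. Let $\mathcal S=\mathcal S(\mathcal U)$ be the set of $u$ in the unit sphere $\mathbf S^{d-1}\subset\mathbb R^d$ for which $\{x\in\mathbb Z^d:\langle x,u\rangle<0\}$ is $\mathcal U$-closed, let $\operatorname{int}(\cdot)$ denote interior in $\mathbf S^{d-1}$, and let $F(\mathcal U)$ be the set of $u\in\mathbf S^{d-1}$ with $\langle x-y,u\rangle=0$ for some distinct $x,y\in X\in\mathcal U$. The family $\mathcal U$ is subcritical if $\operatorname{int}(H\cap\mathcal S)\neq\emptyset$ for every open hemisphere $H\subset\mathbf S^{d-1}$. Fix $1<\beta<3/2$ and $p>0$. Set $\Delta_1=\lfloor p^{-1/(3d+2)}\rfloor$, $\Delta_{k+1}=\lfloor\Delta_k^{1/2}\rfloor\Delta_k$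 and $g_k=\Delta_k^{\beta}$ for $k\ge1$. A $(k)$-cube is a set $x+[0,\Delta_k)^d$ with $x\in(\Delta_k\mathbb Z)^d$. For subsets of $\mathbb R^d$, $d(\mathcal X,\mathcal Y)=\inf\{\|x-y\|:x\in\mathcal X,\,y\in\mathcal Y\}$, and $\mathcal X,\mathcal Y$ are adjacent if $d(\mathcal X,\mathcal Y)=0$. Given $A\subset\mathbb Z^d$, a $(1)$-cube is bad if it meets $A$; for $k\ge2$ a $(k)$-cube $Q$ is bad if there are non-adjacent bad $(k-1)$-cubes $Q_1,Q_2$ with $\max\{d(Q,Q_1),d(Q,Q_2)\}\le g_{k-1}$; a $(k)$-cube that is not bad is good. For $k\ge1$, $\mathcal Q_k(A)$ is the collection of all $Q\subset\mathbb R^d$ such that $Q$ is the union of a maximal collection of pairwise-adjacent bad $(k)$-cubes and $Q$ intersects a good $(k+1)$-cube. For every $k\geq 1$ and $Q\in\mathcal Q_k(A)$ fix an arbitrary point $x_Q\in Q$. Write $B_r(x)$ for the closed Euclidean ball of radius $r$ centred at $x$. **Proposition.** Let $d\ge1$ and let $\mathcal S^*\subset\mathbf S^{d-1}$ be a finite set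 that meets every open hemisphere of $\mathbf S^{d-1}$. There exists $\gamma>0$, depending only on $\mathcal S^*$ (and $d$), such that the following holds. Let $\mathcal U$ be a subcritical $d$-dimensional update family with $\mathcal S^*\subset\operatorname{int}(\mathcal S(\mathcal U))\setminus F(\mathcal U)$, let $1<\beta<3/2$, and let $p>0$ be sufficiently small (depending on $d$, $\mathcal S^*$, $\mathcal U$ and $\beta$). Then for every $A\subset\mathbb Z^d$ and every choice of the points $x_Q$ there are sets $T_k(Q)\subset\mathbb R^d$, for $k\ge1$ and $Q\in\mathcal Q_k(A)$, with $$Q\subset T_k(Q)\subset B_{\gamma\Delta_k}(x_Q),$$ such that $\mathcal T\cap\mathbb Z^d$ is $\mathcal U$-closed, where $$\mathcal T=\bigcup_{k=1}^{\infty}\ \bigcup_{Q\in\mathcal Q_k(A)}T_k(Q).$$ -/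

import Mathlib

open scoped RealInnerProductSpace

noncomputable section

namespace UBootstrap

/-- The lattice `ℤ^d`. -/
abbrev Site (d : ℕ) : Type := Fin d → ℤ

/-- Euclidean space `ℝ^d`, with the Euclidean norm. -/
abbrev Space (d : ℕ) : Type := EuclideanSpace ℝ (Fin d)

/-- The unit sphere `S^{d-1}` in `ℝ^d`, with its usual (subspace) topology. -/
abbrev Direction (d : ℕ) : Type := Metric.sphere (0 : Space d) 1

/-- The inclusion `ℤ^d ⊂ ℝ^d`. -/
def toSpace {d : ℕ} (a : Site d) : Space d := WithLp.toLp 2 (fun i => (a i : ℝ))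

/-- `X ∩ ℤ^d`, for `X ⊂ ℝ^d`. -/
def latticePart {d : ℕ} (X : Set (Space d)) : Set (Site d) := {a | toSpace a ∈ X}

/-! ### The bootstrap process -/

/-- An update family is a finite collection of finite subsets of `ℤ^d \ {0}`. -/
def IsUpdateFamily {d : ℕ} (U : Finset (Finset (Site d))) : Prop :=
  ∀ X ∈ U, (0 : Site d) ∉ X

/-- The set `A_t` of sites infected at time `t`, starting from `A_0 = A`. -/
def infectedAt {d : ℕ} (U : Finset (Finset (Site d))) (A : Set (Site d)) : ℕ → Set (Site d)
  | 0 => A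
  | t + 1 => infectedAt U A t ∪ {x | ∃ X ∈ U, ∀ y ∈ X, x + y ∈ infectedAt U A t}

/-- The `U`-closure `[A]_U` of `A`. -/
def uClosure {d : ℕ} (U : Finset (Finset (Site d))) (A : Set (Site d)) : Set (Site d) :=
  ⋃ t : ℕ, infectedAt U A t

/-- `A` is `U`-closed if `[A]_U = A`. -/
def IsUClosed {d : ℕ} (U : Finset (Finset (Site d))) (A : Set (Site d)) : Prop :=
  uClosure U A = A

/-- The discrete half-space `{x ∈ ℤ^d : ⟨x, u⟩ < 0}`. -/
def halfSpace {d : ℕ} (u : Direction d) : Set (Site d) :=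
  {x | ⟪toSpace x, (u : Space d)⟫ < 0}

/-- The set `S(U)` of stable directions. -/
def stableSet {d : ℕ} (U : Finset (Finset (Site d))) : Set (Direction d) :=
  {u | IsUClosed U (halfSpace u)}

/-- The strongly stable set: the interior of `S(U)` in the topology of the sphere. -/
def stronglyStableSet {d : ℕ} (U : Finset (Finset (Site d))) : Set (Direction d) :=
  interior (stableSet U)

/-- The open hemisphere of `S^{d-1}` centred at `w`. -/
def openHemisphere {d : ℕ} (w : Direction d) : Set (Direction d) :=
  {v | 0 < ⟪(w : Space d), (v : Space d)⟫}

/-- `U` is subcritical if `H ∩ S(U)` has non-empty interior for every hemisphere `H`. -/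
def IsSubcritical {d : ℕ} (U : Finset (Finset (Site d))) : Prop :=
  ∀ w : Direction d, (interior (openHemisphere w ∩ stableSet U)).Nonempty

/-- The set `F(U)` of directions perpendicular to a line joining two sites of an update rule. -/
def perpSet {d : ℕ} (U : Finset (Finset (Site d))) : Set (Direction d) :=
  {u | ∃ X ∈ U, ∃ x ∈ X, ∃ y ∈ X, x ≠ y ∧ ⟪toSpace x - toSpace y, (u : Space d)⟫ = 0}

/-! ### Scales and cubes -/

/-- The side length `Δ_k` of cubes at scale `k ≥ 1` (the value at `k = 0` is never used). -/
def sideLength (d : ℕ) (p : ℝ) : ℕ → ℕ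
  | 0 => 0
  | 1 => ⌊p ^ (-(1 / (3 * (d : ℝ) + 2)))⌋₊
  | k + 2 => ⌊Real.sqrt (sideLength d p (k + 1))⌋₊ * sideLength d p (k + 1)

/-- The range of influence `g_k = Δ_k ^ β`. -/
def influence (d : ℕ) (p β : ℝ) (k : ℕ) : ℝ := (sideLength d p k : ℝ) ^ β

/-- The `(k)`-cubes `x + [0, Δ_k)^d`, for `x ∈ (Δ_k ℤ)^d`. -/
def cubes (d : ℕ) (p : ℝ) (k : ℕ) : Set (Set (Space d)) :=
  {Q | ∃ z : Site d, Q = {x : Space d | ∀ i,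
    (sideLength d p k : ℝ) * z i ≤ x i ∧
      x i < (sideLength d p k : ℝ) * z i + sideLength d p k}}

/-- The distance between two (non-empty) sets: the infimum of `d(x, y)` over `x ∈ X`, `y ∈ Y`. -/
def setDist {d : ℕ} (X Y : Set (Space d)) : ℝ :=
  sInf {r | ∃ x ∈ X, ∃ y ∈ Y, r = dist x y}

/-- Two sets are adjacent if they are at distance zero. -/
def Adjacent {d : ℕ} (X Y : Set (Space d)) : Prop := setDist X Y = 0

/-- The set of bad `(k)`-cubes, for `k ≥ 1` (the value at `k = 0` is never used). -/
def badCubes {d : ℕ} (p β : ℝ) (A : Set (Site d)) : ℕ → Set (Set (Space d))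
  | 0 => ∅
  | 1 => {Q | Q ∈ cubes d p 1 ∧ ∃ a ∈ A, toSpace a ∈ Q}
  | k + 2 => {Q | Q ∈ cubes d p (k + 2) ∧
      ∃ Q₁ ∈ badCubes p β A (k + 1), ∃ Q₂ ∈ badCubes p β A (k + 1),
        ¬ Adjacent Q₁ Q₂ ∧
          max (setDist Q Q₁) (setDist Q Q₂) ≤ influence d p β (k + 1)}

/-- The set of good `(k)`-cubes: those that are not bad. -/
def goodCubes {d : ℕ} (p β : ℝ) (A : Set (Site d)) (k : ℕ) : Set (Set (Space d)) :=
  cubes d p k \ badCubes p β A k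

/-- The collection `𝒬_k(A)` of clusters: unions of maximal collections of pairwise-adjacent
bad `(k)`-cubes that intersect a good `(k+1)`-cube. -/
def clusters {d : ℕ} (p β : ℝ) (A : Set (Site d)) (k : ℕ) : Set (Set (Space d)) :=
  {Q | (∃ C : Set (Set (Space d)),
      Maximal (fun C' => C' ⊆ badCubes p β A k ∧ C'.Pairwise Adjacent) C ∧ Q = ⋃₀ C) ∧
    ∃ Q' ∈ goodCubes p β A (k + 1), (Q ∩ Q').Nonempty}

end UBootstrap

end

open UBootstrap

/-! Each `T k Q` is a polytope about `x k Q` with face normals in `Sstar`, its faces pushed out by a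
height function with small Lipschitz constant `ε`. Since `Sstar` lies in the interior of the stable
set and avoids `perpSet U`, for each normal `u` every rule has a site `y` with `⟪y, u⟫ > ε * ‖y‖`;
this slack keeps the perturbed polytope closed (`isUClosed_region`). A union of closed sets is
closed once any two of them are nested or farther apart than two sites of one rule can be
(`isUClosed_iUnion`).

To arrange this, the height for a cluster is raised near the smaller clusters that its polytope
approaches, from larger scales down to smaller ones (`exists_absorbing_height`). Swallowing a ball
at scale `i` takes a bump of height of order `Δ_i` and slope `ε / 2 ^ i`, hence of width of order `2
^ i * Δ_i / ε`. Clusters of one scale are at least `g_i / 2` apart (`clusters_eq_of_dist_lt`), and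
for small `p` the ratio `g_i / Δ_i = Δ_i ^ (β - 1)` beats any fixed multiple of `2 ^ i`
(`exists_growth`), so a bump dies out before it reaches the next cluster. All raises together are at
most `Δ_k`, so `γ` depends only on `d` and on the coercivity constant `κ` of `Sstar`. -/

namespace UBootstrap

/-! ### Polytopes with Lipschitz heights, and the absorption of smaller balls. -/

/-- Raising a Lipschitz function by conical bumps of height `s` over the points of `N`. -/
theorem exists_raise {E : Type*} [PseudoMetricSpace E] {h : E → ℝ} {L L' s : ℝ} (hL' : 0 ≤ L')
    (hLL' : L ≤ L') (hs : 0 ≤ s)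
    (hlip : ∀ y z, h y ≤ h z + L * dist y z) (N : Set E) :
    ∃ h' : E → ℝ, (∀ y z, h' y ≤ h' z + L' * dist y z) ∧ (∀ y, h y ≤ h' y) ∧
      (∀ y, h' y ≤ h y + s) ∧ (∀ p ∈ N, ∀ z, h p + s - L' * dist z p ≤ h' z) ∧
      ∀ z, (∀ p ∈ N, s ≤ (L' - L) * dist z p) → h' z ≤ h z := by
  set B : E → Set ℝ := fun y => insert (h y) ((fun p => h p + s - L' * dist y p) '' N) with hB
  have hne : ∀ y, (B y).Nonempty := fun y => Set.insert_nonempty _ _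
  have hmono : ∀ y z : E, L * dist y z ≤ L' * dist y z := fun y z =>
    mul_le_mul_of_nonneg_right hLL' dist_nonneg
  have hub : ∀ y, ∀ a ∈ B y, a ≤ h y + s := by
    rintro y a (rfl | ⟨p, -, rfl⟩)
    · linarith
    · have h1 := hlip p y
      have h2 := hmono y p
      rw [dist_comm] at h1
      simp only
      linarith
  have hbdd : ∀ y, BddAbove (B y) := fun y => ⟨_, fun a ha => hub y a ha⟩
  refine ⟨fun y => sSup (B y), fun y z => ?_, fun y => ?_, fun y => ?_, fun p hp z => ?_,
    fun z hz => ?_⟩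
  · refine csSup_le (hne y) ?_
    rintro a (rfl | ⟨p, hp, rfl⟩)
    · have h1 := hlip y z
      have h2 := hmono y z
      have h3 := le_csSup (hbdd z) (Set.mem_insert (h z) _)
      linarith
    · have h3 : h p + s - L' * dist z p ≤ sSup (B z) :=
        le_csSup (hbdd z) (Set.mem_insert_of_mem _ ⟨p, hp, rfl⟩)
      have h4 := mul_le_mul_of_nonneg_left (dist_triangle z y p) hL'
      rw [dist_comm z y] at h4
      simp only
      linarith
  · exact le_csSup (hbdd y) (Set.mem_insert _ _)
  · exact csSup_le (hne y) (hub y)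
  · exact le_csSup (hbdd z) (Set.mem_insert_of_mem _ ⟨p, hp, rfl⟩)
  · refine csSup_le (hne z) ?_
    rintro a (rfl | ⟨p, hp, rfl⟩)
    · exact le_rfl
    · have h1 := hlip p z
      have h2 := hz p hp
      rw [dist_comm] at h1
      simp only
      linarith

section Region

variable {E : Type*} [NormedAddCommGroup E] [InnerProductSpace ℝ E]

/-- The polytope with centre `c` and outer normals `V`, with the distance of its faces from the
centre modulated by the function `h`. -/
def region (V : Set E) (c : E) (h : E → ℝ) : Set E := {y | ∀ u ∈ V, ⟪y - c, u⟫ < h y}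

theorem region_mono {V : Set E} {c : E} {h h' : E → ℝ} (hh : ∀ y, h y ≤ h' y) :
    region V c h ⊆ region V c h' := fun y hy u hu => (hy u hu).trans_le (hh y)

/-- A point that fails to lie in a region by at most `σ` is within distance `2 * σ / κ` of it. -/
theorem exists_mem_region_dist_le {V : Set E} {κ : ℝ} (hκ : 0 < κ)
    (hV : ∀ v : E, ∃ u ∈ V, κ * ‖v‖ ≤ ⟪v, u⟫) {c : E} {h : E → ℝ} {L : ℝ}
    (hL : L ≤ κ / 2) (hlip : ∀ y z, h y ≤ h z + L * dist y z) {σ : ℝ} (hσ : 0 ≤ σ) {z : E}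
    (hz : ∀ u ∈ V, ⟪z - c, u⟫ < h z + σ) (hσz : σ < h z) :
    ∃ z' ∈ region V c h, dist z' z ≤ 2 * σ / κ := by
  set H := h z + σ with hH
  have hHpos : 0 < H := by linarith
  -- Contracting `z` towards `c` by the factor `1 - q` lowers the bound `H` by `2 * σ`: one `σ`
  -- returns to `h z`, the other pays for the variation of `h` along the move.
  set q := 2 * σ / H with hq
  have hqH : q * H = 2 * σ := by rw [hq]; field_simp
  have hq0 : 0 ≤ q := by positivity
  have hq1 : q < 1 := by rw [hq, div_lt_one hHpos]; linarith
  have hnorm : κ * ‖z - c‖ ≤ H := by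
    obtain ⟨u, hu, h1⟩ := hV (z - c)
    exact h1.trans (hz u hu).le
  have hd : dist (c + (1 - q) • (z - c)) z = q * ‖z - c‖ := by
    rw [dist_eq_norm, show c + (1 - q) • (z - c) - z = (-q) • (z - c) by module, norm_smul,
      Real.norm_eq_abs, abs_neg, abs_of_nonneg hq0]
  refine ⟨c + (1 - q) • (z - c), fun u hu => ?_, ?_⟩
  · have h1 := hlip z (c + (1 - q) • (z - c))
    rw [dist_comm, hd] at h1
    have h2 : L * (q * ‖z - c‖) ≤ σ := by
      have h3 : L * ‖z - c‖ ≤ H / 2 := by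
        have := mul_le_mul_of_nonneg_right hL (norm_nonneg (z - c))
        linarith
      have := mul_le_mul_of_nonneg_left h3 hq0
      linarith
    rw [add_sub_cancel_left, real_inner_smul_left]
    have h4 := mul_lt_mul_of_pos_left (hz u hu) (show 0 < 1 - q by linarith)
    linarith
  · rw [hd, le_div_iff₀ hκ]
    have := mul_le_mul_of_nonneg_left hnorm hq0
    linarith

/-- Given separated sets `P i` of centres at scale `D i`, a slowly varying function `h` can be
raised so that every ball of radius `γ * D i` about a centre of scale `i ≤ j` is either contained
in the region of the raised function or far from it. -/
theorem exists_absorbing_height {V : Set E} {κ : ℝ} (hκ : 0 < κ) (hκ1 : κ ≤ 1)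
    (hV : ∀ v : E, ∃ u ∈ V, κ * ‖v‖ ≤ ⟪v, u⟫) (hV1 : ∀ u ∈ V, ‖u‖ ≤ 1) (c : E)
    {γ R ε M : ℝ} (hγ : 0 ≤ γ) (hε : 0 < ε) (hεκ : ε ≤ κ / 2)
    (hM2 : 2 ≤ M) (hMR : 4 * R ≤ M) (hMκ : 8 * (4 * γ + 2) ≤ M * κ)
    (hMε : 8 * (4 * γ + 2) ≤ M * ε) (hMγ : 4 * (γ + 1) ≤ M)
    {D : ℕ → ℝ} (hD0 : D 0 = 0) (hD : ∀ j, M * D j ≤ D (j + 1)) (hDM : ∀ j, M ≤ D (j + 1))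
    {P : ℕ → Set E}
    (hP : ∀ j, ∀ p ∈ P (j + 1), ∀ q ∈ P (j + 1), p ≠ q →
      M * 2 ^ (j + 1) * D (j + 1) ≤ dist p q) (j : ℕ) :
    ∀ h : E → ℝ, (∀ y z, h y ≤ h z + ε / 2 ^ (j + 1) * dist y z) → (∀ y, D (j + 1) ≤ h y) →
    ∃ h' : E → ℝ, (∀ y z, h' y ≤ h' z + ε * dist y z) ∧ (∀ y, h y ≤ h' y) ∧
      (∀ y, h' y ≤ h y + 2 * (4 * γ + 2) * D j) ∧
      ∀ i, 1 ≤ i → i ≤ j → ∀ p ∈ P i,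
        Metric.closedBall p (γ * D i) ⊆ region V c h' ∨
          ∀ z ∈ region V c h', γ * D i + 2 * R < dist z p := by
  have hDnn : ∀ j, 0 ≤ D j := by
    rintro (_ | j)
    · exact hD0.ge
    · linarith [hDM j]
  induction j with
  | zero =>
    intro h hlip hDh
    refine ⟨h, fun y z => (hlip y z).trans ?_, fun y => le_rfl, fun y => by simp [hD0],
      fun i h1 h2 => by omega⟩
    have : ε / 2 ^ (0 + 1) ≤ ε := by norm_num; linarith
    have := mul_le_mul_of_nonneg_right this (dist_nonneg (x := y) (y := z))
    linarith
  | succ j ih =>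
    intro h hlip hDh
    set δ := D (j + 1) with hδ
    set L := ε / 2 ^ (j + 1 + 1) with hL
    have hLpos : 0 < L := by positivity
    have hL' : ε / 2 ^ (j + 1) = 2 * L := by rw [hL, pow_succ 2 (j + 1)]; field_simp
    have hL2 : 2 * L ≤ κ / 2 := by
      rw [← hL']
      refine (div_le_self hε.le ?_).trans hεκ
      exact one_le_pow₀ (by norm_num)
    have hδ0 : 0 ≤ δ := hDnn _
    have hδM : M ≤ δ := hDM j
    have hδR : 2 * R ≤ δ / 2 := by linarith
    have hMκ' : 8 * (4 * γ + 2) ≤ M := by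
      have := mul_le_mul_of_nonneg_left hκ1 (show 0 ≤ M by linarith)
      linarith
    have hδδ : δ ≤ D (j + 1 + 1) := by
      have h1 := hD (j + 1)
      have h2 := mul_le_mul_of_nonneg_right hM2 (hDnn (j + 1))
      linarith
    -- The radius has `γ + 1` in place of `γ`: half of the spare `δ` covers `2 * R`, the other half
    -- the growth of the region caused by later raises at smaller scales.
    set N : Set E := {p ∈ P (j + 1) | ∃ z ∈ region V c h, dist z p ≤ (γ + 1) * δ} with hN
    -- Crossing from a point of the region to any point of the ball costs at most `(2 * γ + 1) * δ`,
    -- and the slopes of `h` and of the bump at most `(γ + 1 / 2) * δ` more.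
    set s := (4 * γ + 2) * δ with hs
    have hs0 : 0 ≤ s := by positivity
    obtain ⟨g, glip, hg, gs, gN, gfar⟩ :=
      exists_raise (L' := 2 * L) (by positivity) (by linarith) hs0 hlip N
    obtain ⟨h', h'lip, hgh', h'g, h'P⟩ := ih g (by rwa [hL'])
      fun y => (hδδ.trans (hDh y)).trans (hg y)
    have hσ1 : 8 * (4 * γ + 2) * D j ≤ δ := by
      have := mul_le_mul_of_nonneg_right hMκ' (hDnn j)
      linarith [hD j]
    refine ⟨h', h'lip, fun y => (hg y).trans (hgh' y), fun y => ?_, fun i hi1 hij p hp => ?_⟩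
    · have h1 := h'g y
      have h2 := gs y
      have h3 : 2 * (4 * γ + 2) * D j ≤ s := by
        have : 0 ≤ (4 * γ + 2) * D j := mul_nonneg (by linarith) (hDnn j)
        have : 0 ≤ γ * δ := by positivity
        linarith
      linarith
    rcases Nat.lt_or_ge i (j + 1) with hlt | hge
    · exact h'P i hi1 (by omega) p hp
    obtain rfl : i = j + 1 := by omega
    by_cases hpN : p ∈ N
    · left
      refine Set.Subset.trans ?_ (region_mono hgh')
      obtain ⟨-, z, hz, hzp⟩ := hpN
      intro y hy u hu
      rw [Metric.mem_closedBall, ← hδ] at hy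
      have h1 := gN p ⟨hp, z, hz, hzp⟩ y
      have h2 := hlip z p
      have h3 := hz u hu
      have h4 : ⟪y - c, u⟫ = ⟪z - c, u⟫ + ⟪y - z, u⟫ := by
        rw [← inner_add_left]; congr 1; abel
      have h5 : ⟪y - z, u⟫ ≤ (2 * γ + 1) * δ := by
        refine (real_inner_le_norm _ _).trans ?_
        have h6 : ‖y - z‖ ≤ (2 * γ + 1) * δ := by
          rw [← dist_eq_norm]
          have := dist_triangle_right y z p
          linarith
        have := mul_le_mul_of_nonneg_left (hV1 u hu) (norm_nonneg (y - z))
        linarith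
      have h7 : 2 * L * dist y p ≤ 1 / 2 * (γ * δ) :=
        mul_le_mul (by linarith) hy dist_nonneg (by norm_num)
      have h8 : L * dist z p ≤ 1 / 2 * ((γ + 1) * δ) :=
        mul_le_mul (by linarith) hzp dist_nonneg (by norm_num)
      have h9 : 0 ≤ γ * δ := by positivity
      rw [h4]
      linarith
    · right
      intro z hz
      by_contra! hzp
      rw [← hδ] at hzp
      -- No bump is felt at `z`: the one at `p` was not made, and the separation factor `2 ^ (j +
      -- 1)` offsets the small slope `L`, so the others have already died out.
      have hgz : g z ≤ h z := by
        refine gfar z fun q hq => ?_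
        have hpq : p ≠ q := by rintro rfl; exact hpN hq
        have h1 := hP j p hp q hq.1 hpq
        have h2 := dist_triangle_left p q z
        have h3 : M * 2 ^ (j + 1) / 2 * δ ≤ dist z q := by
          have h4 : 2 * (γ + 1) ≤ M * 2 ^ (j + 1) / 2 := by
            have : (1 : ℝ) ≤ 2 ^ (j + 1) := one_le_pow₀ (by norm_num)
            have := mul_le_mul_of_nonneg_left this (show 0 ≤ M by linarith)
            linarith
          have := mul_le_mul_of_nonneg_right h4 (hDnn (j + 1))
          rw [← hδ] at this h1
          have : 0 ≤ γ * δ := by positivity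
          linarith
        have h5 := mul_le_mul_of_nonneg_left h3 hLpos.le
        have h6 : L * (M * 2 ^ (j + 1) / 2 * δ) = M * ε / 4 * δ := by
          rw [hL, pow_succ 2 (j + 1)]; field_simp; ring
        have h7 := mul_le_mul_of_nonneg_right hMε (hDnn (j + 1))
        rw [← hδ] at h7
        have : 0 ≤ γ * δ := by positivity
        linarith
      have hσ0 : 0 ≤ 2 * (4 * γ + 2) * D j := mul_nonneg (by linarith) (hDnn j)
      obtain ⟨w, hw, hwz⟩ := exists_mem_region_dist_le hκ hV (by linarith) hlip hσ0
        (z := z) (fun u hu => (hz u hu).trans_le (by linarith [h'g z]))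
        (by linarith [hDh z])
      refine hpN ⟨hp, w, hw, ?_⟩
      have h1 := dist_triangle w z p
      have h2 : 2 * (2 * (4 * γ + 2) * D j) / κ ≤ δ / 2 := by
        rw [div_le_iff₀ hκ]
        have h3 := mul_le_mul_of_nonneg_right hMκ (hDnn j)
        have h4 := mul_le_mul_of_nonneg_right (hD j) hκ.le
        linarith
      linarith

end Region

end UBootstrap

namespace UBootstrap

/-! ### Closed sets of the bootstrap process and quantitative stability. -/

section Bootstrap

variable {d : ℕ} {U : Finset (Finset (Site d))}

theorem isUClosed_iff {A : Set (Site d)} :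
    IsUClosed U A ↔ ∀ X ∈ U, ∀ x, (∀ y ∈ X, x + y ∈ A) → x ∈ A := by
  constructor
  · intro h X hX x hx
    rw [← h]
    exact Set.mem_iUnion.2 ⟨1, Or.inr ⟨X, hX, hx⟩⟩
  · intro h
    refine Set.Subset.antisymm (Set.iUnion_subset fun t => ?_)
      fun x hx => Set.mem_iUnion.2 ⟨0, hx⟩
    induction t with
    | zero => exact subset_rfl
    | succ t ih =>
      rintro x (hx | ⟨X, hX, hx⟩)
      · exact ih hx
      · exact h X hX x fun y hy => ih (hx y hy)

theorem toSpace_add (a b : Site d) : toSpace (a + b) = toSpace a + toSpace b := by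
  ext i; simp [toSpace]

theorem toSpace_zero : toSpace (0 : Site d) = 0 := by
  ext i; simp [toSpace]

theorem toSpace_injective : Function.Injective (toSpace : Site d → Space d) := by
  intro a b h
  ext i
  have := congrArg (fun v : Space d => v i) h
  simpa [toSpace] using this

theorem exists_inner_nonneg_of_mem_stableSet {u : Direction d} (hu : u ∈ stableSet U)
    {X : Finset (Site d)} (hX : X ∈ U) : ∃ y ∈ X, 0 ≤ ⟪toSpace y, (u : Space d)⟫ := by
  by_contra! h
  have := isUClosed_iff.1 hu X hX 0 fun y hy => by simpa [halfSpace] using h y hy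
  simp [halfSpace, toSpace_zero] at this

-- Otherwise stability forces a site `x` of the rule onto the hyperplane orthogonal to `u`, and
-- avoiding `perpSet U` makes it the only one. Tilting `u` slightly away from `x` makes every site
-- strictly negative, yet the tilted direction is still stable.
open Filter Topology in
theorem exists_inner_pos_of_mem_stronglyStableSet (hU : IsUpdateFamily U) {u : Direction d}
    (hu : u ∈ stronglyStableSet U \ perpSet U) {X : Finset (Site d)} (hX : X ∈ U) :
    ∃ y ∈ X, 0 < ⟪toSpace y, (u : Space d)⟫ := by
  by_contra! h
  obtain ⟨x, hx, hx0⟩ := exists_inner_nonneg_of_mem_stableSet (interior_subset hu.1) hX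
  have hxu : ⟪toSpace x, (u : Space d)⟫ = 0 := le_antisymm (h x hx) hx0
  have hneg : ∀ y ∈ X, y ≠ x → ⟪toSpace y, (u : Space d)⟫ < 0 := by
    refine fun y hy hyx => lt_of_le_of_ne (h y hy) fun h0 => hu.2 ⟨X, hX, y, hy, x, hx, hyx, ?_⟩
    rw [inner_sub_left, h0, hxu, sub_zero]
  have hxne : toSpace x ≠ 0 := by
    rw [← toSpace_zero]
    exact fun h0 => hU X hX (toSpace_injective h0 ▸ hx)
  have hu1 : ‖(u : Space d)‖ = 1 := by simp
  have hw : ∀ t : ℝ, (u : Space d) - t • toSpace x ≠ 0 := by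
    intro t ht
    have h1 : ⟪(u : Space d) - t • toSpace x, (u : Space d)⟫ = 0 := by rw [ht, inner_zero_left]
    rw [inner_sub_left, real_inner_smul_left, hxu, real_inner_self_eq_norm_sq, hu1] at h1
    norm_num at h1
  let v : ℝ → Direction d := fun t =>
    ⟨‖(u : Space d) - t • toSpace x‖⁻¹ • ((u : Space d) - t • toSpace x), by
      rw [mem_sphere_zero_iff_norm, norm_smul, norm_inv, norm_norm,
        inv_mul_cancel₀ (norm_ne_zero_iff.2 (hw t))]⟩
  have hv0 : v 0 = u := by
    ext1
    simp [v, hu1]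
  have hvc : Continuous v := by
    refine Continuous.subtype_mk (Continuous.smul (Continuous.inv₀ (by fun_prop) fun t =>
      norm_ne_zero_iff.2 (hw t)) (by fun_prop)) _
  have hstable : ∀ᶠ t in 𝓝[>] (0 : ℝ), v t ∈ stableSet U := by
    have h1 : stableSet U ∈ 𝓝 (v 0) := by rw [hv0]; exact mem_interior_iff_mem_nhds.1 hu.1
    exact (hvc.continuousAt.eventually h1).filter_mono nhdsWithin_le_nhds
  have hall : ∀ᶠ t in 𝓝[>] (0 : ℝ), ∀ y ∈ X, ⟪toSpace y, (u : Space d) - t • toSpace x⟫ < 0 := by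
    rw [Filter.eventually_all_finset]
    intro y hy
    rcases eq_or_ne y x with rfl | hyx
    · filter_upwards [self_mem_nhdsWithin] with t ht
      rw [inner_sub_right, hxu, real_inner_smul_right, zero_sub, neg_lt_zero]
      exact mul_pos ht (real_inner_self_pos.2 hxne)
    · have hc : Continuous fun t : ℝ => ⟪toSpace y, (u : Space d) - t • toSpace x⟫ := by fun_prop
      exact (hc.continuousAt.eventually_lt continuousAt_const
        (by simpa using hneg y hy hyx)).filter_mono nhdsWithin_le_nhds
  obtain ⟨t, ht, hta⟩ := (hstable.and hall).exists
  obtain ⟨y, hy, hy0⟩ := exists_inner_nonneg_of_mem_stableSet ht hX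
  simp only [v, real_inner_smul_right] at hy0
  exact absurd hy0 (not_le.2 (mul_neg_of_pos_of_neg (inv_pos.2 (norm_pos_iff.2 (hw t))) (hta y hy)))

open Filter Topology in
theorem exists_slack {S : Finset (Direction d)}
    (h : ∀ u ∈ S, ∀ X ∈ U, ∃ y ∈ X, 0 < ⟪toSpace y, (u : Space d)⟫) {κ : ℝ} (hκ : 0 < κ) :
    ∃ ε, 0 < ε ∧ ε < κ ∧
      ∀ u ∈ S, ∀ X ∈ U, ∃ y ∈ X, ε * ‖toSpace y‖ < ⟪toSpace y, (u : Space d)⟫ := by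
  have h1 : ∀ᶠ ε in 𝓝[>] (0 : ℝ),
      ∀ u ∈ S, ∀ X ∈ U, ∃ y ∈ X, ε * ‖toSpace y‖ < ⟪toSpace y, (u : Space d)⟫ := by
    simp only [Filter.eventually_all_finset]
    intro u hu X hX
    obtain ⟨y, hy, hy0⟩ := h u hu X hX
    have hc : Continuous fun ε : ℝ => ε * ‖toSpace y‖ := by fun_prop
    have h2 := (hc.continuousAt (x := 0)).eventually_lt
      (continuousAt_const (y := ⟪toSpace y, (u : Space d)⟫)) (by simpa using hy0)
    filter_upwards [h2.filter_mono nhdsWithin_le_nhds] with ε hε using ⟨y, hy, hε⟩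
  obtain ⟨ε, ⟨h1, h2⟩, h3, h4⟩ :=
    (h1.and ((eventually_mem_nhdsWithin).and (eventually_nhdsWithin_of_eventually_nhds
      (eventually_lt_nhds hκ)))).exists.imp fun ε h => (⟨⟨h.1, h.1⟩, h.2⟩ : (_ ∧ _) ∧ _ ∧ _)
  exact ⟨ε, h3, h4, h1⟩

/-- For each normal, the site with slack gains more in that direction than the height can vary over
the same step, so the face inequality passes back from it to the origin of the rule. -/
theorem isUClosed_region {V : Set (Space d)} {ε : ℝ}
    (hV : ∀ u ∈ V, ∀ X ∈ U, ∃ y ∈ X, ε * ‖toSpace y‖ < ⟪toSpace y, u⟫) {h : Space d → ℝ}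
    (hlip : ∀ y z, h y ≤ h z + ε * dist y z) (c : Space d) :
    IsUClosed U (latticePart (region V c h)) := by
  refine isUClosed_iff.2 fun X hX x hx u hu => ?_
  obtain ⟨y, hy, hyu⟩ := hV u hu X hX
  have h1 := hx y hy u hu
  have h2 := hlip (toSpace (x + y)) (toSpace x)
  rw [toSpace_add] at h1 h2
  rw [dist_eq_norm, add_sub_cancel_left] at h2
  rw [add_sub_right_comm, inner_add_left] at h1
  linarith

/-- A union of closed sets, any two of which are nested or far apart, is closed. -/
theorem isUClosed_iUnion {ι : Type*} {T : ι → Set (Space d)} (k : ι → ℕ) {R : ℝ}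
    (hT : ∀ i, IsUClosed U (latticePart (T i))) (hne : ∀ X ∈ U, X.Nonempty)
    (hR : ∀ X ∈ U, ∀ y ∈ X, ‖toSpace y‖ ≤ R)
    (hsep : ∀ i j, k i ≤ k j → T i ⊆ T j ∨ ∀ a ∈ T i, ∀ b ∈ T j, 2 * R < dist a b) :
    IsUClosed U (latticePart (⋃ i, T i)) := by
  refine isUClosed_iff.2 fun X hX x hx => ?_
  have hx' : ∀ y : X, ∃ i, toSpace (x + (y : Site d)) ∈ T i := fun y => Set.mem_iUnion.1 (hx y y.2)
  choose f hf using hx'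
  have : Nonempty X := (hne X hX).to_subtype
  -- A set of largest scale among those meeting the translated rule contains the whole of it, since
  -- none of the others can be far away.
  obtain ⟨y₀, -, hmax⟩ := Finset.exists_max_image Finset.univ (fun y => k (f y))
    Finset.univ_nonempty
  refine Set.mem_iUnion.2 ⟨f y₀, isUClosed_iff.1 (hT (f y₀)) X hX x fun y hy => ?_⟩
  rcases hsep _ _ (hmax ⟨y, hy⟩ (Finset.mem_univ _)) with h | h
  · exact h (hf ⟨y, hy⟩)
  · exfalso
    have h1 := h _ (hf ⟨y, hy⟩) _ (hf y₀)
    rw [toSpace_add, toSpace_add, dist_add_left] at h1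
    have h2 := dist_le_norm_add_norm (toSpace y) (toSpace (y₀ : Site d))
    linarith [hR X hX y hy, hR X hX y₀ y₀.2]

theorem exists_norm_toSpace_le (U : Finset (Finset (Site d))) :
    ∃ R, 0 ≤ R ∧ ∀ X ∈ U, ∀ y ∈ X, ‖toSpace y‖ ≤ R := by
  refine ⟨∑ X ∈ U, ∑ y ∈ X, ‖toSpace y‖, by positivity, fun X hX y hy => ?_⟩
  refine (Finset.single_le_sum (f := fun y => ‖toSpace y‖) (fun _ _ => norm_nonneg _) hy).trans ?_
  exact Finset.single_le_sum (f := fun X : Finset (Site d) => ∑ y ∈ X, ‖toSpace y‖)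
    (fun _ _ => by positivity) hX

theorem direction_nonempty (hd : 1 ≤ d) : Nonempty (Direction d) :=
  ⟨⟨EuclideanSpace.single ⟨0, hd⟩ 1, by simp⟩⟩

/-- By compactness of the sphere, the largest inner product with a member of `S`, continuous and
positive, attains a positive minimum. -/
theorem exists_coercive (hd : 1 ≤ d) {S : Finset (Direction d)}
    (hS : ∀ w : Direction d, ∃ u ∈ S, u ∈ openHemisphere w) :
    ∃ κ : ℝ, 0 < κ ∧ κ ≤ 1 ∧ ∀ v : Space d, ∃ u ∈ S, κ * ‖v‖ ≤ ⟪v, (u : Space d)⟫ := by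
  have := direction_nonempty hd
  have hSne : S.Nonempty := let ⟨u, hu, _⟩ := hS (Classical.arbitrary _); ⟨u, hu⟩
  have hc : Continuous fun w : Direction d => S.sup' hSne fun u => ⟪(w : Space d), (u : Space d)⟫ :=
    Continuous.finset_sup'_apply hSne fun u _ => by fun_prop
  obtain ⟨w, -, hw⟩ := isCompact_univ.exists_isMinOn Set.univ_nonempty hc.continuousOn
  obtain ⟨κ, hκ, hκw⟩ : ∃ κ : ℝ, 0 < κ ∧
      ∀ w : Direction d, ∃ u ∈ S, κ ≤ ⟪(w : Space d), (u : Space d)⟫ := by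
    refine ⟨_, ?_, fun w' => Finset.le_sup'_iff hSne |>.1 (hw (Set.mem_univ w'))⟩
    obtain ⟨u, hu, hwu⟩ := hS w
    exact (Finset.lt_sup'_iff hSne).2 ⟨u, hu, hwu⟩
  have key : ∀ v : Space d, ∃ u ∈ S, κ * ‖v‖ ≤ ⟪v, (u : Space d)⟫ := by
    intro v
    rcases eq_or_ne v 0 with rfl | hv
    · obtain ⟨u, hu⟩ := hSne
      exact ⟨u, hu, by simp⟩
    · have hv' := norm_pos_iff.2 hv
      obtain ⟨u, hu, h⟩ := hκw ⟨‖v‖⁻¹ • v, by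
        rw [mem_sphere_zero_iff_norm, norm_smul, norm_inv, norm_norm, inv_mul_cancel₀ hv'.ne']⟩
      refine ⟨u, hu, ?_⟩
      rwa [real_inner_smul_left, inv_mul_eq_div, le_div_iff₀ hv'] at h
  refine ⟨min κ 1, lt_min hκ one_pos, min_le_right _ _, fun v => ?_⟩
  obtain ⟨u, hu, h⟩ := key v
  exact ⟨u, hu, (mul_le_mul_of_nonneg_right (min_le_left _ _) (norm_nonneg v)).trans h⟩

end Bootstrap

/-! ### Diameter and separation of clusters. -/

section Cubes

variable {d : ℕ} {p β : ℝ} {A : Set (Site d)} {k : ℕ}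

theorem setDist_le_dist {X Y : Set (Space d)} {x y : Space d} (hx : x ∈ X) (hy : y ∈ Y) :
    setDist X Y ≤ dist x y :=
  csInf_le ⟨0, by rintro _ ⟨_, _, _, _, rfl⟩; exact dist_nonneg⟩ ⟨x, hx, y, hy, rfl⟩

theorem dist_le_of_mem_cubes {Q : Set (Space d)} (hQ : Q ∈ cubes d p k) {x y : Space d}
    (hx : x ∈ Q) (hy : y ∈ Q) : dist x y ≤ d * sideLength d p k := by
  obtain ⟨z, rfl⟩ := hQ
  have hb : ∀ i, |x i - y i| ≤ sideLength d p k := fun i => by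
    have h1 := hx i
    have h2 := hy i
    rw [abs_le]
    constructor <;> linarith
  rw [EuclideanSpace.dist_eq]
  refine Real.sqrt_le_iff.2 ⟨by positivity, ?_⟩
  have h1 : ∑ i, dist (x i) (y i) ^ 2 ≤ ∑ _i : Fin d, (sideLength d p k : ℝ) ^ 2 :=
    Finset.sum_le_sum fun i _ => pow_le_pow_left₀ dist_nonneg (hb i) 2
  refine h1.trans ?_
  rw [Finset.sum_const, Finset.card_univ, Fintype.card_fin, nsmul_eq_mul, mul_pow]
  refine mul_le_mul_of_nonneg_right ?_ (by positivity)
  exact_mod_cast Nat.le_self_pow two_ne_zero d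

theorem dist_le_of_adjacent {Q Q' : Set (Space d)} (hQ : Q ∈ cubes d p k)
    (hQ' : Q' ∈ cubes d p k) (h : Adjacent Q Q') {x y : Space d} (hx : x ∈ Q) (hy : y ∈ Q') :
    dist x y ≤ 2 * d * sideLength d p k := by
  refine le_of_forall_pos_le_add fun η hη => ?_
  have hlt : setDist Q Q' < η := by rwa [show setDist Q Q' = 0 from h]
  obtain ⟨_, ⟨a, ha, b, hb, rfl⟩, hab⟩ := exists_lt_of_csInf_lt
    (show Set.Nonempty {r | ∃ x ∈ Q, ∃ y ∈ Q', r = dist x y} from ⟨_, x, hx, y, hy, rfl⟩) hlt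
  have h1 := dist_triangle4 x a b y
  have h2 := dist_le_of_mem_cubes hQ hx ha
  have h3 := dist_le_of_mem_cubes hQ' hb hy
  linarith

theorem badCubes_subset_cubes : badCubes p β A k ⊆ cubes d p k := by
  match k with
  | 0 => exact Set.empty_subset _
  | 1 => exact fun Q hQ => hQ.1
  | k + 2 => exact fun Q hQ => hQ.1

theorem dist_le_of_pairwise_adjacent {C : Set (Set (Space d))} (hC : C ⊆ badCubes p β A k)
    (hadj : C.Pairwise Adjacent) {x y : Space d} (hx : x ∈ ⋃₀ C) (hy : y ∈ ⋃₀ C) :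
    dist x y ≤ 2 * d * sideLength d p k := by
  obtain ⟨Q, hQ, hx⟩ := hx
  obtain ⟨Q', hQ', hy⟩ := hy
  rcases eq_or_ne Q Q' with rfl | hne
  · have h1 := dist_le_of_mem_cubes (badCubes_subset_cubes (hC hQ)) hx hy
    have h2 : 0 ≤ (d : ℝ) * sideLength d p k := by positivity
    linarith
  · exact dist_le_of_adjacent (badCubes_subset_cubes (hC hQ)) (badCubes_subset_cubes (hC hQ'))
      (hadj hQ hQ' hne) hx hy

theorem dist_le_of_mem_clusters {Q : Set (Space d)} (hQ : Q ∈ clusters p β A k) {x y : Space d}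
    (hx : x ∈ Q) (hy : y ∈ Q) : dist x y ≤ 2 * d * sideLength d p k := by
  obtain ⟨⟨C, hC, rfl⟩, -⟩ := hQ
  exact dist_le_of_pairwise_adjacent hC.prop.1 hC.prop.2 hx hy

theorem adjacent_of_goodCubes {Q B B' : Set (Space d)} (hQ : Q ∈ goodCubes p β A (k + 2))
    (hB : B ∈ badCubes p β A (k + 1)) (hB' : B' ∈ badCubes p β A (k + 1))
    (h : setDist Q B ≤ influence d p β (k + 1)) (h' : setDist Q B' ≤ influence d p β (k + 1)) :
    Adjacent B B' := by
  by_contra hadj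
  exact hQ.2 ⟨hQ.1, B, hB, B', hB', hadj, max_le h h'⟩

/-- Distinct clusters at the same scale are far apart. -/
theorem clusters_eq_of_dist_lt {Q Q' : Set (Space d)} (hQ : Q ∈ clusters p β A (k + 1))
    (hQ' : Q' ∈ clusters p β A (k + 1))
    (hpos : 0 < sideLength d p (k + 1))
    (hg : 8 * d * sideLength d p (k + 1) ≤ influence d p β (k + 1)) {x y : Space d}
    (hx : x ∈ Q) (hy : y ∈ Q') (hxy : dist x y < influence d p β (k + 1) / 2) : Q = Q' := by
  obtain ⟨⟨C, hC, rfl⟩, G, hG, q, hqC, hqG⟩ := hQ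
  obtain ⟨⟨C', hC', rfl⟩, -⟩ := hQ'
  have hqx := dist_le_of_pairwise_adjacent hC.prop.1 hC.prop.2 hqC hx
  have h0 : 0 ≤ (d : ℝ) * sideLength d p (k + 1) := by positivity
  have hbad : C ∪ C' ⊆ badCubes p β A (k + 1) := Set.union_subset hC.prop.1 hC'.prop.1
  have hne : ∀ B ∈ badCubes p β A (k + 1), B.Nonempty := by
    intro B hB
    obtain ⟨z, rfl⟩ := badCubes_subset_cubes hB
    refine ⟨WithLp.toLp 2 fun i => (sideLength d p (k + 1) : ℝ) * z i, fun i => ?_⟩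
    simp [hpos]
  -- One good cube `G` meeting the first cluster suffices: every cube of both clusters is within its
  -- range, so goodness makes them pairwise adjacent and maximality merges the two collections.
  have hclose : ∀ B ∈ C ∪ C', setDist G B ≤ influence d p β (k + 1) := by
    rintro B (hB | hB)
    · obtain ⟨b, hb⟩ := hne B (hbad (Or.inl hB))
      have h1 := dist_le_of_pairwise_adjacent hC.prop.1 hC.prop.2 hqC ⟨B, hB, hb⟩
      exact (setDist_le_dist hqG hb).trans (by linarith)
    · obtain ⟨b, hb⟩ := hne B (hbad (Or.inr hB))
      have h1 := dist_le_of_pairwise_adjacent hC'.prop.1 hC'.prop.2 hy ⟨B, hB, hb⟩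
      have h2 := dist_triangle4 q x y b
      exact (setDist_le_dist hqG hb).trans (by linarith)
  have hprop : C ∪ C' ⊆ badCubes p β A (k + 1) ∧ (C ∪ C').Pairwise Adjacent :=
    ⟨hbad, fun B hB B' hB' _ =>
      adjacent_of_goodCubes hG (hbad hB) (hbad hB') (hclose B hB) (hclose B' hB')⟩
  rw [hC.eq_of_subset hprop Set.subset_union_left, ← hC'.eq_of_subset hprop Set.subset_union_right]

end Cubes

end UBootstrap

namespace UBootstrap

/-! ### Growth of the scales for small `p`. -/

section Growth

open Filter Topology

/-- For small `p`, the side lengths grow by an arbitrarily large factor from scale to scale, and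
the ranges of influence exceed the side lengths by arbitrarily large, growing factors. -/
theorem exists_growth (d : ℕ) {β : ℝ} (hβ : 1 < β) (M : ℝ) :
    ∃ p₀ : ℝ, 0 < p₀ ∧ ∀ p : ℝ, 0 < p → p < p₀ →
      (∀ j, M * sideLength d p j ≤ sideLength d p (j + 1)) ∧
      (∀ j, M ≤ sideLength d p (j + 1)) ∧
      ∀ j, M * 2 ^ (j + 1) * sideLength d p (j + 1) ≤ influence d p β (j + 1) / 2 := by
  have hβ' : 0 < β - 1 := by linarith
  obtain ⟨N, hN1, hNM, hN2, hNβ⟩ : ∃ N : ℕ, 1 ≤ N ∧ M ≤ N ∧ 2 ≤ (N : ℝ) ^ (β - 1) ∧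
      4 * M ≤ (N : ℝ) ^ (β - 1) := by
    have h1 := (tendsto_rpow_atTop hβ').comp (tendsto_natCast_atTop_atTop (R := ℝ))
    exact ((eventually_ge_atTop 1).and ((tendsto_natCast_atTop_atTop.eventually_ge_atTop M).and
      ((h1.eventually_ge_atTop 2).and (h1.eventually_ge_atTop (4 * M))))).exists
  have hlim : Tendsto (fun p : ℝ => sideLength d p 1) (𝓝[>] 0) atTop := by
    refine tendsto_nat_floor_atTop.comp (tendsto_rpow_neg_nhdsGT_zero ?_)
    have : (0 : ℝ) < 1 / (3 * d + 2) := by positivity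
    linarith
  obtain ⟨p₀, hp₀, hsub⟩ := mem_nhdsGT_iff_exists_Ioo_subset.1 (hlim.eventually_ge_atTop (N ^ 2))
  refine ⟨p₀, hp₀, fun p hp hpp₀ => ?_⟩
  have hD1 : N ^ 2 ≤ sideLength d p 1 := hsub ⟨hp, hpp₀⟩
  have hstep : ∀ j, N ^ 2 ≤ sideLength d p (j + 1) →
      N * sideLength d p (j + 1) ≤ sideLength d p (j + 2) := by
    intro j hj
    refine Nat.mul_le_mul_right _ (Nat.le_floor (Real.le_sqrt_of_sq_le ?_))
    exact_mod_cast hj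
  have hge : ∀ j, N ^ 2 ≤ sideLength d p (j + 1) := by
    intro j
    induction j with
    | zero => exact hD1
    | succ j ih => exact ih.trans ((Nat.le_mul_of_pos_left _ hN1).trans (hstep j ih))
  have hDN : ∀ j, (N : ℝ) ≤ sideLength d p (j + 1) := fun j => by
    exact_mod_cast (Nat.le_self_pow two_ne_zero N).trans (hge j)
  have hstep' : ∀ j, (N : ℝ) * sideLength d p (j + 1) ≤ sideLength d p (j + 2) := fun j => by
    exact_mod_cast hstep j (hge j)
  -- The exponent `j + 2` absorbs the halving of the influence range. Each scale gains a factor `N ^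
  -- (β - 1) ≥ 2`.
  have hpow : ∀ j, M * 2 ^ (j + 2) ≤ (sideLength d p (j + 1) : ℝ) ^ (β - 1) := by
    intro j
    induction j with
    | zero =>
      refine le_trans (by norm_num [mul_comm]) (hNβ.trans ?_)
      exact Real.rpow_le_rpow (by positivity) (hDN 0) hβ'.le
    | succ j ih =>
      have h1 := Real.rpow_le_rpow (by positivity) (hstep' j) hβ'.le
      rw [Real.mul_rpow (by positivity) (by positivity)] at h1
      refine le_trans ?_ h1
      have h2 : (0 : ℝ) ≤ (sideLength d p (j + 1) : ℝ) ^ (β - 1) := by positivity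
      have h3 := mul_le_mul_of_nonneg_right hN2 h2
      rw [pow_succ]
      linarith
  refine ⟨fun j => ?_, fun j => hNM.trans (hDN j), fun j => ?_⟩
  · cases j with
    | zero => simp [sideLength]
    | succ j => exact (mul_le_mul_of_nonneg_right hNM (by positivity)).trans (hstep' j)
  · have hpos : (0 : ℝ) < sideLength d p (j + 1) :=
      lt_of_lt_of_le (by exact_mod_cast hN1) (hDN j)
    have h1 : influence d p β (j + 1) =
        (sideLength d p (j + 1) : ℝ) ^ (β - 1) * sideLength d p (j + 1) := by
      rw [influence, ← Real.rpow_add_one hpos.ne']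
      congr 1
      ring
    have h2 := mul_le_mul_of_nonneg_right (hpow j) hpos.le
    rw [pow_succ 2 (j + 1)] at h2
    rw [h1]
    linarith

end Growth

end UBootstrap

/-! ### Construction of the sets and assembly. -/

theorem proposition3p3 (d : ℕ) (hd : 1 ≤ d)
    (Sstar : Finset (Direction d))
    (hSstar : ∀ w : Direction d, ∃ u ∈ Sstar, u ∈ openHemisphere w) :
    ∃ γ : ℝ, 0 < γ ∧
      ∀ U : Finset (Finset (Site d)), IsUpdateFamily U → IsSubcritical U →
        (∀ u ∈ Sstar, u ∈ stronglyStableSet U \ perpSet U) →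
      ∀ β : ℝ, 1 < β → β < 3 / 2 →
      ∃ p₀ : ℝ, 0 < p₀ ∧ ∀ p : ℝ, 0 < p → p < p₀ →
      ∀ A : Set (Site d),
      ∀ x : ℕ → Set (Space d) → Space d,
        (∀ k : ℕ, 1 ≤ k → ∀ Q ∈ clusters p β A k, x k Q ∈ Q) →
      ∃ T : ℕ → Set (Space d) → Set (Space d),
        (∀ k : ℕ, 1 ≤ k → ∀ Q ∈ clusters p β A k,
          Q ⊆ T k Q ∧ T k Q ⊆ Metric.closedBall (x k Q) (γ * sideLength d p k)) ∧
        IsUClosed U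
          (latticePart (⋃ (k : ℕ) (_ : 1 ≤ k) (Q ∈ clusters p β A k), T k Q)) := by
  obtain ⟨κ, hκ, hκ1, hcoer⟩ := exists_coercive hd hSstar
  have hγ : 0 < (2 * d + 2) / κ := by positivity
  -- The height is at most `2 * d + 1` (base) plus `1` (all raises) side lengths; coercivity turns
  -- this into a radius on dividing by `κ`.
  refine ⟨(2 * d + 2) / κ, hγ, fun U hU _ hS β hβ _ => ?_⟩
  set γ : ℝ := (2 * d + 2) / κ with hγdef
  have hγκ : γ * κ = 2 * d + 2 := by rw [hγdef]; field_simp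
  obtain ⟨ε, hε, hεκ, hslack⟩ := exists_slack (U := U) (S := Sstar)
    (fun u hu X hX => exists_inner_pos_of_mem_stronglyStableSet hU (hS u hu) hX) (half_pos hκ)
  obtain ⟨R, hR0, hR⟩ := exists_norm_toSpace_le U
  set V : Set (Space d) := (↑) '' (Sstar : Set (Direction d)) with hVdef
  have hV : ∀ v : Space d, ∃ u ∈ V, κ * ‖v‖ ≤ ⟪v, u⟫ := fun v =>
    let ⟨u, hu, h⟩ := hcoer v; ⟨u, ⟨u, hu, rfl⟩, h⟩
  have hV1 : ∀ u ∈ V, ‖u‖ ≤ 1 := by rintro _ ⟨u, -, rfl⟩; simp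
  have hVslack : ∀ u ∈ V, ∀ X ∈ U, ∃ y ∈ X, ε * ‖toSpace y‖ < ⟪toSpace y, u⟫ := by
    rintro _ ⟨u, hu, rfl⟩ X hX
    exact hslack u hu X hX
  have hne : ∀ X ∈ U, X.Nonempty := fun X hX => by
    obtain ⟨u, hu, -⟩ := hV 0
    obtain ⟨y, hy, -⟩ := hVslack u hu X hX
    exact ⟨y, hy⟩
  obtain ⟨M, hM2, hMR, hMκ, hMε, hMγ, hMd⟩ : ∃ M : ℝ, 2 ≤ M ∧ 4 * R ≤ M ∧
      8 * (4 * γ + 2) ≤ M * κ ∧ 8 * (4 * γ + 2) ≤ M * ε ∧ 4 * (γ + 1) ≤ M ∧ 8 * d ≤ M := by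
    simp only [← div_le_iff₀ hκ, ← div_le_iff₀ hε]
    open Filter in
    exact ((eventually_ge_atTop _).and ((eventually_ge_atTop _).and ((eventually_ge_atTop _).and
      ((eventually_ge_atTop _).and ((eventually_ge_atTop _).and (eventually_ge_atTop _)))))).exists
  obtain ⟨p₀, hp₀, hgrow⟩ := exists_growth d hβ M
  refine ⟨p₀, hp₀, fun p hp hpp₀ A x hx => ?_⟩
  obtain ⟨hD, hDM, hg⟩ := hgrow p hp hpp₀
  have hsep : ∀ j, ∀ Q ∈ clusters p β A (j + 1), ∀ Q' ∈ clusters p β A (j + 1), Q ≠ Q' →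
      M * 2 ^ (j + 1) * sideLength d p (j + 1) ≤ dist (x (j + 1) Q) (x (j + 1) Q') := by
    intro j Q hQ Q' hQ' hQQ'
    by_contra! hlt
    have hpos : (0 : ℝ) < sideLength d p (j + 1) := by linarith [hDM j]
    refine hQQ' (clusters_eq_of_dist_lt hQ hQ' (by exact_mod_cast hpos) ?_
      (hx _ (by omega) Q hQ) (hx _ (by omega) Q' hQ') (hlt.trans_le (hg j)))
    have h1 : M ≤ M * 2 ^ (j + 1) :=
      le_mul_of_one_le_right (by linarith) (one_le_pow₀ (by norm_num))
    have h2 := mul_le_mul_of_nonneg_right (hMd.trans h1) hpos.le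
    have h3 : 0 ≤ 8 * d * (sideLength d p (j + 1) : ℝ) := by positivity
    linarith [hg j]
  have hexists : ∀ (k : ℕ) (Q : Set (Space d)), ∃ T : Set (Space d),
      1 ≤ k → Q ∈ clusters p β A k →
        Q ⊆ T ∧ T ⊆ Metric.closedBall (x k Q) (γ * sideLength d p k) ∧
        IsUClosed U (latticePart T) ∧
        ∀ i, 1 ≤ i → i < k → ∀ Q' ∈ clusters p β A i,
          Metric.closedBall (x i Q') (γ * sideLength d p i) ⊆ T ∨
            ∀ z ∈ T, γ * sideLength d p i + 2 * R < dist z (x i Q') := by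
    intro k Q
    rcases k with _ | m
    · exact ⟨∅, fun h => absurd h (by omega)⟩
    obtain ⟨h, hlip, hge, hle, hdich⟩ := exists_absorbing_height hκ hκ1 hV hV1 (x (m + 1) Q)
      hγ.le hε hεκ.le hM2 hMR hMκ hMε hMγ (D := fun k => (sideLength d p k : ℝ))
      (by simp [sideLength]) hD hDM (P := fun i => x i '' clusters p β A i)
      (by
        rintro j _ ⟨Q, hQ, rfl⟩ _ ⟨Q', hQ', rfl⟩ hne
        exact hsep j Q hQ Q' hQ' fun h => hne (h ▸ rfl)) m
      -- A cluster has diameter at most `2 * d` side lengths; the extra one makes the face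
      -- inequalities strict.
      (fun _ => (2 * d + 1) * (sideLength d p (m + 1) : ℝ))
      (fun y z => le_add_of_nonneg_right (by positivity))
      (fun _ => le_mul_of_one_le_left (by positivity) (by norm_cast; omega))
    refine ⟨region V (x (m + 1) Q) h, fun _ hQ => ⟨fun y hy u hu => ?_, fun y hy => ?_,
      isUClosed_region hVslack hlip _, fun i hi him Q' hQ' => ?_⟩⟩
    · have h1 := dist_le_of_mem_clusters hQ hy (hx _ (by omega) Q hQ)
      have h2 : ⟪y - x (m + 1) Q, u⟫ ≤ dist y (x (m + 1) Q) := by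
        rw [dist_eq_norm]
        exact (real_inner_le_norm _ _).trans
          (mul_le_of_le_one_right (norm_nonneg _) (hV1 u hu))
      have h3 := hge y
      linarith [hDM m]
    · obtain ⟨u, hu, h1⟩ := hV (y - x (m + 1) Q)
      have h2 := hy u hu
      have h3 := hle y
      have h4 : 2 * (4 * γ + 2) * (sideLength d p m : ℝ) ≤ sideLength d p (m + 1) := by
        refine le_trans (mul_le_mul_of_nonneg_right ?_ (by positivity)) (hD m)
        have := mul_le_mul_of_nonneg_left hκ1 (show 0 ≤ M by linarith)
        linarith
      rw [Metric.mem_closedBall, dist_eq_norm, hγdef, div_mul_eq_mul_div, le_div_iff₀ hκ]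
      linarith
    · exact hdich i hi (by omega) _ ⟨Q', hQ', rfl⟩
  choose T hT using hexists
  refine ⟨T, fun k hk Q hQ => ⟨(hT k Q hk hQ).1, (hT k Q hk hQ).2.1⟩, ?_⟩
  let ι := {q : ℕ × Set (Space d) // 1 ≤ q.1 ∧ q.2 ∈ clusters p β A q.1}
  have hunion : (⋃ (k : ℕ) (_ : 1 ≤ k) (Q ∈ clusters p β A k), T k Q) =
      ⋃ i : ι, T i.1.1 i.1.2 := by
    ext y
    simp only [Set.mem_iUnion, ι, Subtype.exists, Prod.exists, exists_prop]
    constructor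
    · rintro ⟨k, hk, Q, hQ, hy⟩
      exact ⟨k, Q, ⟨hk, hQ⟩, hy⟩
    · rintro ⟨k, Q, ⟨hk, hQ⟩, hy⟩
      exact ⟨k, hk, Q, hQ, hy⟩
  rw [hunion]
  refine isUClosed_iUnion (fun i : ι => i.1.1) (fun i => (hT _ _ i.2.1 i.2.2).2.2.1) hne hR ?_
  rintro ⟨⟨k, Q⟩, hk, hQ⟩ ⟨⟨k', Q'⟩, hk', hQ'⟩ hkk'
  simp only at hk hQ hk' hQ' hkk' ⊢
  have hball := (hT k Q hk hQ).2.1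
  rcases hkk'.lt_or_eq with hlt | rfl
  · refine ((hT k' Q' hk' hQ').2.2.2 k hk hlt Q hQ).imp hball.trans fun hfar a ha b hb => ?_
    have h1 := hfar b hb
    have h2 := Metric.mem_closedBall.1 (hball ha)
    have h3 := dist_triangle_left b (x k Q) a
    linarith
  · rcases eq_or_ne Q Q' with rfl | hQQ'
    · exact Or.inl subset_rfl
    · right
      intro a ha b hb
      obtain ⟨j, rfl⟩ : ∃ j, k = j + 1 := ⟨k - 1, by omega⟩
      have h1 := hsep j Q hQ Q' hQ' hQQ'
      have h2 := Metric.mem_closedBall'.1 (hball ha)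
      have h3 := Metric.mem_closedBall.1 ((hT _ Q' hk' hQ').2.1 hb)
      have h4 := dist_triangle4 (x (j + 1) Q) a b (x (j + 1) Q')
      have hDj := hDM j
      have h5 : 4 * (γ + 1) ≤ M * 2 ^ (j + 1) :=
        hMγ.trans (le_mul_of_one_le_right (by linarith) (one_le_pow₀ (by norm_num)))
      have hpos : (0 : ℝ) < sideLength d p (j + 1) := by linarith
      have h6 := mul_le_mul_of_nonneg_right h5 hpos.le
      have h7 := mul_pos hγ hpos
      linarith
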